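/- All fields lie in a fixed algebraic closure $\overline{\mathbb Q}$ of $\mathbb Q$, and $H$ denotes the absolute multiplicative Weil height on $\overline{\mathbb Q}$. A set $\mathcal A\subseteq\overline{\mathbb Q}$ has the Northcott property if for every real $X>0$ there are only finitely many $\alpha\in\mathcal A$ with $H(\alpha)\le X$. For number fields $F\subseteq M$, let $D_{M/F}$ be the relative discriminant, i.e. the ideal of $\mathcal O_F$ generated by the discriminants of all $F$-bases of $M$ contained in $\mathcal O_M$, and let $N_{F/\mathbb Q}(D_{M/F})$ be its norm, regarded as a positive integer. Theorem. Let $K$ be a number field, let $K=K_0\subsetneq K_1\subsetneq K_2\subsetneq\cdots$ be a nested sequence of finite extensions, and set $L=\bigcup_i K_i$. Suppose that $$\inf_{K_{i-1}\subsetneq M\subseteq K_i} N_{K_{i-1}/\mathbb Q}\bigl(D_{M/K_{i-1}}\bigr)^{\frac{1}{[M:K_0]\,[M:K_{i-1}]}}\longrightarrow\infty\qquad\text{as } i\to\infty,$$ where for each $i\ge 1$ the infimum is taken over all fields $M$ with $K_{i-1}\subsetneq M\subseteq K_i$. Then the field $L$ has the Northcott property. -/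

import Mathlib

open NumberField

/-- A set `A` of algebraic numbers has the Northcott property if for every positive real `X` it
contains only finitely many elements of absolute multiplicative Weil height at most `X`. -/
def HasNorthcottProperty {Ω : Type*} [Field Ω] [CharZero Ω] (A : Set Ω) : Prop :=
  ∀ X : ℝ, 0 < X → {α : Ω | α ∈ A ∧ absMulHeight₁ α ≤ X}.Finite

/-- The relative discriminant ideal `D_{M/F}` of an extension `M/F` of number fields: the ideal of
`𝓞 F` generated by the discriminants of all `F`-bases of `M` that consist of algebraic
integers. -/
noncomputable def relDiscrIdeal (F M : Type*) [Field F] [Field M] [Algebra F M] : Ideal (𝓞 F) :=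
  Ideal.span {d : 𝓞 F | ∃ b : Module.Basis (Fin (Module.finrank F M)) F M,
    (∀ j, IsIntegral ℤ (b j)) ∧ algebraMap (𝓞 F) F d = Algebra.discr F b}

/-- For subfields `F ≤ M` of `Ω`, with `F` a number field and `M / F` finite, the positive integer
`N_{F/ℚ}(D_{M/F})`. -/
noncomputable def relDiscrNorm {Ω : Type*} [Field Ω] [CharZero Ω] (F M : IntermediateField ℚ Ω)
    [NumberField F] (h : F ≤ M) : ℕ :=
  Ideal.absNorm (relDiscrIdeal F (IntermediateField.extendScalars h))

/-- The degree `[M : F]` for subfields `F ≤ M` of `Ω`. -/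
noncomputable def fieldDegree {Ω : Type*} [Field Ω] [CharZero Ω] (F M : IntermediateField ℚ Ω)
    (h : F ≤ M) : ℕ :=
  Module.finrank F (IntermediateField.extendScalars h)

/-!
Let `F = K i`, let `α ∈ K (i + 1)` lie outside `F`, and put `M = F(α)`, `d = [M : F]`. The
heart of the matter is a Silverman-type inequality (`relDiscrNorm_adjoin_le`)
`N(D_{M/F}) ≤ (4 H(α)⁴) ^ ([F : ℚ] d²)`: an element of small height can only generate an extension
of small discriminant. Its exponent matches the one in the hypothesis, so that `α` of height at most
`X` forces the infimum at stage `i` to be at most the constant `(4 X⁴) ^ [K 0 : ℚ]`. As the infima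
tend to infinity, all elements of `L` of height at most `X` lie in one fixed `K i₀`, where Northcott's
theorem for number fields applies.

The inequality compares `D_{M/F}` with the discriminant `δ` of the power basis `1, α, …, α^(d-1)`.
Let `B` be the denominator ideal of `α` in `𝓞 M`. For nonzero `b ∈ B ^ (d - 1)` the multiples
`b α^j`, `j < d`, are algebraic integers and form an `F`-basis of `M` of discriminant
`N_{M/F}(b)² δ`. The squares of these norms
generate the square of the relative norm of `B ^ (d - 1)` (`Ideal.span_image_sq`), so
`N(D_{M/F}) ≤ |N(δ)| N(B)^(2(d-1))` (`absNorm_relDiscrIdeal_le_norm_discr_mul`). The Vandermonde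
formula bounds `|N(δ)|` by the archimedean part of the height (`abs_norm_discr_powerBasis_le`), and
`N(B)` is precisely the nonarchimedean part.

Since `absMulHeight₁ α` is defined through `ℚ(α)`, the heights over different number fields have to be
compared. This is `mulHeight₁_algebraMap`, deduced from an expression of the height in terms
of complex embeddings and the norm of the ideal `(a, n)`, where `α = a / n`.
-/

/-! ### Heights and field extensions -/

theorem prod_infinitePlace_eq_prod_embeddings {K : Type*} [Field K] [NumberField K]
    (x : K) (f : ℝ → ℝ) :
    ∏ v : InfinitePlace K, f (v x) ^ v.mult = ∏ φ : K →+* ℂ, f ‖φ x‖ := by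
  classical
  rw [← Finset.prod_fiberwise Finset.univ InfinitePlace.mk (fun φ : K →+* ℂ ↦ f ‖φ x‖)]
  refine Finset.prod_congr rfl fun w _ ↦ ?_
  rw [← InfinitePlace.card_filter_mk_eq, ← Finset.prod_const]
  refine Finset.prod_congr rfl fun φ hφ ↦ ?_
  rw [← (Finset.mem_filter.mp hφ).2, InfinitePlace.apply]

/-- The height of `x = a / n` in terms of complex embeddings and the norm of the ideal `(a, n)`, the
latter being inverse, up to a power of `n`, to the nonarchimedean part of the height. -/
theorem mulHeight₁_mul_absNorm {K : Type*} [Field K] [NumberField K] {x : K} {n : ℕ}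
    (hn : n ≠ 0) {a : 𝓞 K} (h : n * x = a) :
    Height.mulHeight₁ x * (Ideal.span {a, (n : 𝓞 K)}).absNorm =
      n ^ Module.finrank ℚ K * ∏ φ : K →+* ℂ, max ‖φ x‖ 1 := by
  have hn' : (n : K) ≠ 0 := mod_cast hn
  have hx : x = a / n := by rw [← h, mul_div_cancel_left₀ _ hn']
  have hv (i : Fin 2) : ((![a, (n : 𝓞 K)] i : 𝓞 K) : K) = ![(a : K), n] i := by
    fin_cases i <;> rfl
  have key := absNorm_mul_finprod_finitePlace_eq_one (show ![a, (n : 𝓞 K)] ≠ 0 by simp [hn])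
  have hr : Set.range ![a, (n : 𝓞 K)] = {a, (n : 𝓞 K)} := by simp [Set.pair_comm]
  simp_rw [hv, hr] at key
  have harch : ∏ v : InfinitePlace K, (⨆ i, v (![(a : K), (n : K)] i)) ^ v.mult =
      n ^ Module.finrank ℚ K * ∏ φ : K →+* ℂ, max ‖φ x‖ 1 := by
    rw [← prod_infinitePlace_eq_prod_embeddings x (fun t ↦ max t 1),
      ← InfinitePlace.sum_mult_eq, ← Finset.prod_pow_eq_pow_sum Finset.univ,
      ← Finset.prod_mul_distrib]
    refine Finset.prod_congr rfl fun v _ ↦ ?_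
    rw [← mul_pow]
    congr 1
    have hvn : v (n : K) = n := by
      rw [← v.norm_embedding_eq, map_natCast, Complex.norm_natCast]
    have : (fun i ↦ v (![(a : K), (n : K)] i)) = ![v (a : K), v (n : K)] := by
      ext i; fin_cases i <;> rfl
    rw [this, show (⨆ i, (![v (a : K), v (n : K)] i)) = max (v (a : K)) (v (n : K)) from
        eq_of_forall_ge_iff <| by simp [ciSup_le_iff, Fin.forall_fin_two],
      ← h, map_mul, hvn, mul_max_of_nonneg _ _ (by positivity), mul_one]
  rw [hx, Height.mulHeight₁_div_eq_mulHeight, mulHeight_eq (by simp [hn]), mul_assoc,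
    mul_comm (finprod _), key, mul_one, harch, hx]


open scoped Classical in
/-- The embeddings of `M` that extend `ψ : K →+* ℂ` are the `K`-algebra homomorphisms to `ℂ`, where
`ℂ` is a `K`-algebra through `ψ`. -/
theorem prod_filter_comp_algebraMap_eq {K M : Type*} [Field K] [NumberField K] [Field M]
    [NumberField M] [Algebra K M] (ψ : K →+* ℂ) (g : (M →+* ℂ) → ℝ) :
    let := ψ.toAlgebra
    ∏ φ : M →+* ℂ with φ.comp (algebraMap K M) = ψ, g φ = ∏ σ : M →ₐ[K] ℂ, g σ := by
  let := ψ.toAlgebra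
  refine Eq.symm <| Finset.prod_bij (fun σ _ ↦ (σ : M →+* ℂ)) (fun σ _ ↦ ?_)
    (fun σ _ τ _ h ↦ AlgHom.coe_ringHom_injective h) (fun φ hφ ↦ ?_) (fun _ _ ↦ rfl)
  · exact Finset.mem_filter.mpr ⟨Finset.mem_univ _, σ.comp_algebraMap⟩
  · exact ⟨⟨φ, RingHom.congr_fun (Finset.mem_filter.mp hφ).2⟩, Finset.mem_univ _, rfl⟩

theorem prod_embeddings_algebraMap {K M : Type*} [Field K] [NumberField K] [Field M]
    [NumberField M] [Algebra K M] (x : K) (f : ℂ → ℝ) :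
    ∏ φ : M →+* ℂ, f (φ (algebraMap K M x)) =
      (∏ φ : K →+* ℂ, f (φ x)) ^ Module.finrank K M := by
  classical
  rw [← Finset.prod_fiberwise Finset.univ (fun φ : M →+* ℂ ↦ φ.comp (algebraMap K M)),
    ← Finset.prod_pow]
  refine Finset.prod_congr rfl fun ψ _ ↦ ?_
  rw [prod_filter_comp_algebraMap_eq ψ (fun φ ↦ f (φ (algebraMap K M x)))]
  let := ψ.toAlgebra
  rw [← AlgHom.card K M ℂ, ← Finset.card_univ, ← Finset.prod_const]
  refine Finset.prod_congr rfl fun σ _ ↦ ?_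
  exact congrArg f (σ.commutes x)

open Height in
/-- The relative multiplicative height is raised to the power `[M : K]` on passing from `K` to `M`. -/
theorem mulHeight₁_algebraMap {K M : Type*} [Field K] [NumberField K] [Field M]
    [NumberField M] [Algebra K M] (x : K) :
    mulHeight₁ (algebraMap K M x) = mulHeight₁ x ^ Module.finrank K M := by
  obtain ⟨n, hn, a, hna, -⟩ :=
    exists_nat_ne_zero_exists_integer_mul_eq_and_absNorm_span_eq_pow x
  have hK := mulHeight₁_mul_absNorm hn hna
  have hna' : n * algebraMap K M x = (algebraMap (𝓞 K) (𝓞 M) a : 𝓞 M) := by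
    rw [← map_natCast (algebraMap K M), ← map_mul, hna]
    rfl
  have hM := mulHeight₁_mul_absNorm hn hna'
  have hmap : Ideal.span {algebraMap (𝓞 K) (𝓞 M) a, (n : 𝓞 M)} =
      (Ideal.span {a, (n : 𝓞 K)}).map (algebraMap (𝓞 K) (𝓞 M)) := by
    rw [Ideal.map_span, Set.image_pair, map_natCast]
  have hfr : Module.finrank (𝓞 K) (𝓞 M) = Module.finrank K M :=
    (IsFractionRing.finrank_eq (𝓞 K) K (𝓞 M) M).symm
  have hN : ((Ideal.span {a, (n : 𝓞 K)}).absNorm : ℝ) ≠ 0 := by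
    rw [Nat.cast_ne_zero, Ne, Ideal.absNorm_eq_zero_iff]
    intro h0
    have : (n : 𝓞 K) ∈ Ideal.span {a, (n : 𝓞 K)} := Ideal.subset_span (by simp)
    rw [h0, Ideal.mem_bot] at this
    exact hn (mod_cast this)
  rw [hmap, Ideal.absNorm_algebraMap, hfr, prod_embeddings_algebraMap x (fun z ↦ max ‖z‖ 1),
    ← Module.finrank_mul_finrank ℚ K M, pow_mul, ← mul_pow, ← hK, mul_pow, Nat.cast_pow] at hM
  exact mul_right_cancel₀ (pow_ne_zero _ hN) hM

open Height IntermediateField in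
/-- The absolute height can be computed in any number field `M` containing the element, not only in
the field generated by it. -/
theorem mulHeight₁_eq_absMulHeight₁_pow {Ω M : Type*} [Field Ω] [CharZero Ω] [Field M]
    [NumberField M] (ι : M →+* Ω) (x : M) :
    mulHeight₁ x = absMulHeight₁ (ι x) ^ Module.finrank ℚ M := by
  let ι' : M →ₐ[ℚ] Ω := ι.toRatAlgHom
  have hx : IsIntegral ℚ (ι x) := (IsIntegral.of_finite ℚ x).map ι'
  have : FiniteDimensional ℚ ℚ⟮ι x⟯ := adjoin.finiteDimensional hx
  have : NumberField ℚ⟮ι x⟯ := {}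
  have hle : ℚ⟮ι x⟯ ≤ ι'.fieldRange := by
    rw [adjoin_simple_le_iff]
    exact ⟨x, rfl⟩
  let j : ℚ⟮ι x⟯ →ₐ[ℚ] M :=
    (AlgEquiv.ofInjectiveField ι').symm.toAlgHom.comp (inclusion hle)
  have hj : j (AdjoinSimple.gen ℚ (ι x)) = x := by
    apply ι'.injective
    have := (AlgEquiv.ofInjectiveField ι').apply_symm_apply
      (inclusion hle (AdjoinSimple.gen ℚ (ι x)))
    exact congrArg Subtype.val this
  let : Algebra ℚ⟮ι x⟯ M := j.toRingHom.toAlgebra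
  have := mulHeight₁_algebraMap (M := M) (AdjoinSimple.gen ℚ (ι x))
  rw [show algebraMap ℚ⟮ι x⟯ M (AdjoinSimple.gen ℚ (ι x)) = x from hj] at this
  rw [this, absMulHeight₁, dif_pos hx, ← Module.finrank_mul_finrank ℚ ℚ⟮ι x⟯ M, pow_mul]
  congr 1
  rw [← Real.rpow_natCast, ← Real.rpow_mul (mulHeight₁_nonneg _), inv_mul_cancel₀, Real.rpow_one]
  exact_mod_cast Module.finrank_pos.ne'

/-! ### The relative discriminant and the discriminant of a power basis -/

/-- In a Dedekind domain the squares of a generating set of `I` generate `I ^ 2`: otherwise they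
would all lie in `I ^ 2 * p` for a maximal ideal `p`, and then `I ≤ I * p`. -/
theorem Ideal.span_image_sq {R : Type*} [CommRing R] [IsDedekindDomain R] (S : Set R) :
    Ideal.span ((· ^ 2) '' S) = Ideal.span S ^ 2 := by
  set I := Ideal.span S with hI
  have hle : Ideal.span ((· ^ 2) '' S) ≤ I ^ 2 := by
    rw [Ideal.span_le]
    rintro _ ⟨x, hx, rfl⟩
    exact Ideal.pow_mem_pow (Ideal.subset_span hx) 2
  rcases eq_or_ne I ⊥ with h0 | h0
  · rw [h0, sq, Ideal.bot_mul] at hle ⊢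
    exact le_bot_iff.mp hle
  obtain ⟨Q, hQ⟩ := Ideal.dvd_iff_le.mpr hle
  suffices Q = ⊤ by rw [hQ, this, Ideal.mul_top]
  by_contra hQ1
  obtain ⟨p, hp, hQp⟩ := Ideal.exists_le_maximal Q hQ1
  have key : I ≤ I * p := by
    conv_lhs => rw [hI]
    rw [Ideal.span_le]
    intro x hx
    obtain ⟨X, hX⟩ := Ideal.dvd_iff_le.mpr
      ((Ideal.span_singleton_le_iff_mem I).mpr (Ideal.subset_span hx))
    have h1 : x ^ 2 ∈ I ^ 2 * p := by
      have : x ^ 2 ∈ Ideal.span ((· ^ 2) '' S) := Ideal.subset_span ⟨x, hx, rfl⟩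
      rw [hQ] at this
      exact Ideal.mul_mono_right hQp this
    have h2 : I ^ 2 * X ^ 2 ≤ I ^ 2 * p := by
      rwa [← mul_pow, ← hX, Ideal.span_singleton_pow, Ideal.span_singleton_le_iff_mem]
    have h3 : p ∣ X ^ 2 :=
      (mul_dvd_mul_iff_left (pow_ne_zero 2 h0)).mp (Ideal.dvd_iff_le.mpr h2)
    have h4 : X ≤ p := hp.isPrime.le_of_pow_le (Ideal.dvd_iff_le.mp h3)
    have : Ideal.span {x} ≤ I * p := hX ▸ Ideal.mul_mono_right h4
    exact (Ideal.span_singleton_le_iff_mem _).mp this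
  have h5 : p ∣ 1 := by
    rw [← mul_dvd_mul_iff_left h0, mul_one]
    exact Ideal.dvd_iff_le.mpr key
  exact hp.ne_top (by simpa [Ideal.one_eq_top, Ideal.dvd_iff_le] using h5)

theorem isIntegral_mul_pow_of_mem_pow {M : Type*} [Field M] {x : M} {B : Ideal (𝓞 M)}
    (hB : ∀ b ∈ B, IsIntegral ℤ (b * x)) (j : ℕ) {b : 𝓞 M} (hb : b ∈ B ^ j) :
    IsIntegral ℤ (b * x ^ j) := by
  induction j generalizing b with
  | zero => simpa using b.isIntegral_coe
  | succ j ih =>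
    rw [pow_succ] at hb
    refine Submodule.mul_induction_on hb (fun b hb c hc ↦ ?_) (fun b c hb hc ↦ ?_)
    · have := (ih hb).mul (hB c hc)
      push_cast
      rwa [pow_succ, mul_mul_mul_comm]
    · push_cast
      rw [add_mul]
      exact hb.add hc

/-- Multiplication of a basis by `b` multiplies its discriminant by the square of the norm of `b`. -/
theorem discr_mul_left {F M ι : Type*} [Field F] [Field M] [Algebra F M] [Fintype ι]
    [DecidableEq ι] (e : Module.Basis ι F M) (b : M) :
    Algebra.discr F (fun i ↦ b * e i) = Algebra.norm F b ^ 2 * Algebra.discr F e := by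
  have : (fun i ↦ b * e i) =
      Matrix.vecMul e ((Algebra.leftMulMatrix e b).map (algebraMap F M)) := by
    funext i
    conv_lhs => rw [← e.sum_repr (b * e i)]
    simp only [Matrix.vecMul, dotProduct, Matrix.map_apply, Algebra.leftMulMatrix_eq_repr_mul,
      Algebra.smul_def, mul_comm]
  rw [this, Algebra.discr_of_matrix_vecMul, Algebra.norm_eq_matrix_det e]

/-- If `b, b α, …, b α^(d-1)` are integral, then the discriminant of this basis lies in
`D_{M/F}`. -/
theorem exists_mem_relDiscrIdeal {F M : Type*} [Field F] [NumberField F] [Field M]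
    [NumberField M] [Algebra F M] (pb : PowerBasis F M) {b : M} (hb0 : b ≠ 0)
    (hb : ∀ i : Fin pb.dim, IsIntegral ℤ (b * pb.gen ^ (i : ℕ))) :
    ∃ d ∈ relDiscrIdeal F M,
      (d : F) = Algebra.norm F b ^ 2 * Algebra.discr F pb.basis := by
  let e := finCongr pb.finrank.symm
  let B : Module.Basis (Fin pb.dim) F M := pb.basis.map
    (LinearEquiv.smulOfNeZero M M b hb0 |>.restrictScalars F)
  have hB (i) : B i = b * pb.basis i := by simp [B]
  have hBi (i) : IsIntegral ℤ (B i) := by rw [hB, pb.coe_basis]; exact hb i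
  have hd : IsIntegral ℤ (Algebra.discr F B) := Algebra.discr_isIntegral F hBi
  refine ⟨⟨Algebra.discr F B, hd⟩, Ideal.subset_span ⟨B.reindex e, fun j ↦ ?_, ?_⟩, ?_⟩
  · rw [Module.Basis.reindex_apply]; exact hBi _
  · rw [Module.Basis.coe_reindex, Algebra.discr_reindex]
    rfl
  · rw [← discr_mul_left pb.basis b]
    exact congrArg (Algebra.discr F) (funext hB)

/-- The norm of `D_{M/F}` is bounded through any nonzero ideal `B` of denominators of the generator
of a power basis. -/
theorem absNorm_relDiscrIdeal_le_norm_discr_mul {F M : Type*} [Field F] [NumberField F] [Field M]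
    [NumberField M] [Algebra F M] (pb : PowerBasis F M) {B : Ideal (𝓞 M)} (hB0 : B ≠ ⊥)
    (hB : ∀ b ∈ B, IsIntegral ℤ (b * pb.gen)) :
    ((relDiscrIdeal F M).absNorm : ℝ) ≤
      |(Algebra.norm ℚ (Algebra.discr F pb.basis) : ℝ)| * (B.absNorm : ℝ) ^ (2 * (pb.dim - 1)) := by
  set δ := Algebra.discr F pb.basis with hδ
  have hδ0 : δ ≠ 0 := Algebra.discr_not_zero_of_basis F pb.basis
  obtain ⟨x, y, hy, hxy⟩ := IsFractionRing.div_surjective (A := 𝓞 F) δ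
  have hy0 : y ≠ 0 := nonZeroDivisors.ne_zero hy
  have hyF : (y : F) ≠ 0 := by simpa using hy0
  have hx0 : x ≠ 0 := by
    rintro rfl
    simp [hδ0.symm] at hxy
  have hxy' : (x : F) = y * δ := by
    rw [← hxy]; field_simp
  set R := (B ^ (pb.dim - 1)).relNorm (𝓞 F) with hR
  -- The fractional ideal `δ R²` is contained in `D_{M/F}`; its denominator `y` has been cleared.
  have hle : Ideal.span {x} * R ^ 2 ≤ Ideal.span {y} * relDiscrIdeal F M := by
    have : R = Ideal.span (Algebra.intNorm (𝓞 F) (𝓞 M) '' (B ^ (pb.dim - 1) : Ideal (𝓞 M))) := rfl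
    rw [this, ← Ideal.span_image_sq, Ideal.span_mul_span', Ideal.span_le]
    rintro _ ⟨x, rfl, _, ⟨_, ⟨b, hb, rfl⟩, rfl⟩, rfl⟩
    rcases eq_or_ne b 0 with rfl | hb0
    · simp
    obtain ⟨d, hd, hdeq⟩ := exists_mem_relDiscrIdeal pb (b := b) (by simpa using hb0)
      (fun i ↦ isIntegral_mul_pow_of_mem_pow hB i (Ideal.pow_le_pow_right (by lia) hb))
    refine Ideal.mem_span_singleton_mul.mpr ⟨d, hd, ?_⟩
    apply FaithfulSMul.algebraMap_injective (𝓞 F) F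
    simp only [map_mul, map_pow]
    rw [Algebra.algebraMap_intNorm (K := F) (L := M), show algebraMap (𝓞 F) F d = _ from hdeq,
      show algebraMap (𝓞 F) F x = _ from hxy']
    ring
  have hdvd := Ideal.absNorm_dvd_absNorm_of_le hle
  rw [map_mul, map_mul, map_pow, hR, Ideal.absNorm_relNorm, map_pow, ← pow_mul,
    Ideal.absNorm_span_singleton, Ideal.absNorm_span_singleton, mul_comm (pb.dim - 1)] at hdvd
  have hxN : 0 < (Algebra.norm ℤ x).natAbs :=
    Int.natAbs_pos.mpr (Algebra.norm_ne_zero_iff.mpr hx0)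
  have hyN : 0 < (Algebra.norm ℤ y).natAbs :=
    Int.natAbs_pos.mpr (Algebra.norm_ne_zero_iff.mpr hy0)
  have hBN : 0 < B.absNorm := Nat.pos_of_ne_zero (Ideal.absNorm_eq_zero_iff.not.mpr hB0)
  have hle' := Nat.le_of_dvd (by positivity) hdvd
  have hnorm : |(Algebra.norm ℚ δ : ℝ)| * (Algebra.norm ℤ y).natAbs =
      (Algebra.norm ℤ x).natAbs := by
    have h1 := congrArg (Algebra.norm ℚ) hxy'
    rw [map_mul, ← Algebra.coe_norm_int, ← Algebra.coe_norm_int] at h1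
    rw [Nat.cast_natAbs, Nat.cast_natAbs, Int.cast_abs, Int.cast_abs, ← abs_mul, mul_comm]
    exact_mod_cast (congrArg (fun q : ℚ ↦ |(q : ℝ)|) h1).symm
  refine le_of_mul_le_mul_left ?_ (show (0 : ℝ) < (Algebra.norm ℤ y).natAbs by exact_mod_cast hyN)
  rw [← mul_assoc, mul_comm _ |_|, hnorm]
  exact_mod_cast hle'

/-- The discriminant of the powers of `α` is the square of a Vandermonde determinant in the
conjugates of `α` over `F`. The exponents are not optimal, since each factor is extended to all pairs
of conjugates. -/
theorem abs_norm_discr_powerBasis_le {F M : Type*} [Field F] [NumberField F] [Field M]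
    [NumberField M] [Algebra F M] (pb : PowerBasis F M) :
    |(Algebra.norm ℚ (Algebra.discr F pb.basis) : ℝ)| ≤
      4 ^ (Module.finrank ℚ F * pb.dim ^ 2) *
        (∏ φ : M →+* ℂ, max ‖φ pb.gen‖ 1) ^ (4 * pb.dim) := by
  classical
  set g : (M →+* ℂ) → ℝ := fun φ ↦ max ‖φ pb.gen‖ 1 with hg
  have hg1 (φ) : 1 ≤ g φ := le_max_right _ _
  have hnorm : |(Algebra.norm ℚ (Algebra.discr F pb.basis) : ℝ)| =
      ∏ ψ : F →+* ℂ, ‖ψ (Algebra.discr F pb.basis)‖ := by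
    rw [← Fintype.prod_equiv (RingHom.equivRatAlgHom F ℂ).symm
      (fun σ ↦ ‖σ (Algebra.discr F pb.basis)‖) _ (fun _ ↦ rfl), ← norm_prod,
      ← Algebra.norm_eq_prod_embeddings ℚ ℂ, eq_ratCast, Complex.norm_ratCast]
  have hfib (ψ : F →+* ℂ) : ‖ψ (Algebra.discr F pb.basis)‖ ≤
      4 ^ (pb.dim ^ 2) * (∏ φ : M →+* ℂ with φ.comp (algebraMap F M) = ψ, g φ) ^ (4 * pb.dim) := by
    rw [prod_filter_comp_algebraMap_eq ψ g]
    let := ψ.toAlgebra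
    have hcard : Fintype.card (M →ₐ[F] ℂ) = pb.dim := by rw [AlgHom.card, pb.finrank]
    let e : Fin pb.dim ≃ (M →ₐ[F] ℂ) := (Fintype.equivFinOfCardEq hcard).symm
    have he : ∏ σ : M →ₐ[F] ℂ, g σ = ∏ i, g (e i) := (Fintype.prod_equiv e _ _ fun _ ↦ rfl).symm
    have hd := Algebra.discr_powerBasis_eq_prod F ℂ pb e
    rw [show ψ (Algebra.discr F pb.basis) = algebraMap F ℂ _ from rfl, hd, he]
    have hpair (σ τ : M →ₐ[F] ℂ) : ‖(σ pb.gen - τ pb.gen) ^ 2‖ ≤ (2 * (g τ * g σ)) ^ 2 := by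
      rw [norm_pow]
      gcongr
      have h1 : ‖σ pb.gen‖ ≤ g σ := le_max_left _ _
      have h2 : ‖τ pb.gen‖ ≤ g τ := le_max_left _ _
      nlinarith [norm_sub_le (σ pb.gen) (τ pb.gen), hg1 σ, hg1 τ]
    have hone (σ τ : M →ₐ[F] ℂ) : 1 ≤ (2 * (g τ * g σ)) ^ 2 :=
      one_le_pow₀ (by nlinarith [hg1 σ, hg1 τ])
    rw [norm_prod]
    calc ∏ i, ‖∏ j ∈ Finset.Ioi i, (e j pb.gen - e i pb.gen) ^ 2‖
        ≤ ∏ i, ∏ j, (2 * (g (e i) * g (e j))) ^ 2 := by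
          refine Finset.prod_le_prod (fun _ _ ↦ norm_nonneg _) fun i _ ↦ ?_
          rw [norm_prod]
          refine (Finset.prod_le_prod (fun _ _ ↦ norm_nonneg _)
            fun j _ ↦ hpair (e j) (e i)).trans ?_
          exact Finset.prod_le_prod_of_subset_of_one_le (Finset.subset_univ _)
            (fun _ _ ↦ by positivity) (fun _ _ _ ↦ hone _ _)
      _ = 4 ^ (pb.dim ^ 2) * (∏ i, g (e i)) ^ (4 * pb.dim) := by
          simp only [mul_pow, Finset.prod_mul_distrib, Finset.prod_const, Finset.prod_pow,
            Finset.card_univ, Fintype.card_fin]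
          ring
  rw [hnorm]
  refine (Finset.prod_le_prod (fun _ _ ↦ norm_nonneg _) fun ψ _ ↦ hfib ψ).trans_eq ?_
  rw [Finset.prod_mul_distrib, Finset.prod_const, Finset.prod_pow,
    Finset.prod_fiberwise Finset.univ (fun φ : M →+* ℂ ↦ φ.comp (algebraMap F M)), ← pow_mul,
    Finset.card_univ, Embeddings.card, mul_comm (pb.dim ^ 2)]

/-! ### Discriminants and heights of generators -/

open Height in
/-- A Silverman-type inequality, in terms of the height relative to `M` of a generator of `M / F`. -/
theorem absNorm_relDiscrIdeal_le {F M : Type*} [Field F] [NumberField F] [Field M]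
    [NumberField M] [Algebra F M] (pb : PowerBasis F M) :
    ((relDiscrIdeal F M).absNorm : ℝ) ≤
      4 ^ (Module.finrank ℚ F * pb.dim ^ 2) * mulHeight₁ pb.gen ^ (4 * pb.dim) := by
  obtain ⟨n, hn, a, hna, -⟩ :=
    exists_nat_ne_zero_exists_integer_mul_eq_and_absNorm_span_eq_pow pb.gen
  have hnM : (n : 𝓞 M) ≠ 0 := mod_cast hn
  set J : Ideal (𝓞 M) := Ideal.span {a, (n : 𝓞 M)} with hJ
  have hnJ : Ideal.span {(n : 𝓞 M)} ≤ J := Ideal.span_mono (by simp)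
  -- `B = n J⁻¹` is the denominator ideal of the generator.
  obtain ⟨B, hB⟩ := Ideal.dvd_iff_le.mpr hnJ
  have hn0 : Ideal.span {(n : 𝓞 M)} ≠ ⊥ := by simpa using hnM
  have hB0 : B ≠ ⊥ := by
    rintro rfl
    exact hn0 (by rw [hB, Ideal.mul_bot])
  have hJ0 : J ≠ ⊥ := ne_bot_of_le_ne_bot hn0 hnJ
  have hint : ∀ b ∈ B, IsIntegral ℤ (b * pb.gen) := by
    intro b hb
    have : a * b ∈ Ideal.span {(n : 𝓞 M)} := by
      rw [hB]
      exact Ideal.mul_mem_mul (Ideal.subset_span (by simp)) hb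
    obtain ⟨c, hc⟩ := Ideal.mem_span_singleton.mp this
    have hcb : b * pb.gen = (c : M) := by
      apply mul_left_cancel₀ (show (n : M) ≠ 0 from mod_cast hn)
      have hc' : (a : M) * b = n * c := by exact_mod_cast congrArg (algebraMap (𝓞 M) M) hc
      rw [← hc', ← hna]
      ring
    rw [hcb]
    exact c.isIntegral_coe
  have hheight : (∏ φ : M →+* ℂ, max ‖φ pb.gen‖ 1) * B.absNorm = mulHeight₁ pb.gen := by
    have h1 := mulHeight₁_mul_absNorm hn hna
    have h2 : (J.absNorm : ℝ) * B.absNorm = n ^ Module.finrank ℚ M := by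
      rw [← RingOfIntegers.rank, ← Nat.cast_mul, ← map_mul, ← hB, Ideal.absNorm_span_natCast,
        Nat.cast_pow]
    rw [← h2] at h1
    have hJN : (J.absNorm : ℝ) ≠ 0 := by
      rw [Nat.cast_ne_zero]
      exact Ideal.absNorm_eq_zero_iff.not.mpr hJ0
    apply mul_left_cancel₀ hJN
    linear_combination -h1
  have hBN : (1 : ℝ) ≤ B.absNorm := by
    exact_mod_cast Nat.one_le_iff_ne_zero.mpr (Ideal.absNorm_eq_zero_iff.not.mpr hB0)
  calc ((relDiscrIdeal F M).absNorm : ℝ)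
      ≤ |(Algebra.norm ℚ (Algebra.discr F pb.basis) : ℝ)| * (B.absNorm : ℝ) ^ (2 * (pb.dim - 1)) :=
        absNorm_relDiscrIdeal_le_norm_discr_mul pb hB0 hint
    _ ≤ 4 ^ (Module.finrank ℚ F * pb.dim ^ 2) *
          (∏ φ : M →+* ℂ, max ‖φ pb.gen‖ 1) ^ (4 * pb.dim) * (B.absNorm : ℝ) ^ (4 * pb.dim) := by
        gcongr
        · exact abs_norm_discr_powerBasis_le pb
        · norm_num
        · lia
    _ = _ := by rw [mul_assoc, ← mul_pow, hheight]

open IntermediateField Module in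
/-- A Silverman-type inequality for the absolute height of a generator of `M / F`. -/
theorem relDiscrNorm_adjoin_le {Ω : Type*} [Field Ω] [CharZero Ω] [IsAlgClosure ℚ Ω]
    (F M : IntermediateField ℚ Ω) [NumberField F] (h : F ≤ M) (α : Ω)
    (hM : M = F ⊔ ℚ⟮α⟯) :
    (relDiscrNorm F M h : ℝ) ≤
      (4 * absMulHeight₁ α ^ 4) ^ (finrank ℚ F * fieldDegree F M h ^ 2) := by
  have hE : extendScalars h = F⟮α⟯ := by
    apply restrictScalars_injective (K := ℚ)
    exact hM.trans (restrictScalars_adjoin_eq_sup (F := ℚ) F {α}).symm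
  rw [relDiscrNorm, fieldDegree, hE]
  have : Algebra.IsAlgebraic ℚ Ω := IsAlgClosure.isAlgebraic
  have hα : IsIntegral F α := (Algebra.IsIntegral.isIntegral (R := ℚ) α).tower_top
  have : FiniteDimensional F F⟮α⟯ := adjoin.finiteDimensional hα
  have : NumberField F⟮α⟯ := NumberField.of_module_finite F _
  have key := absNorm_relDiscrIdeal_le (adjoin.powerBasis hα)
  have hdim : (adjoin.powerBasis hα).dim = finrank F F⟮α⟯ := (PowerBasis.finrank _).symm
  have hgen : algebraMap F⟮α⟯ Ω (adjoin.powerBasis hα).gen = α := by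
    rw [adjoin.powerBasis_gen, AdjoinSimple.algebraMap_gen]
  rw [mulHeight₁_eq_absMulHeight₁_pow (algebraMap F⟮α⟯ Ω), hgen, hdim,
    ← finrank_mul_finrank ℚ F F⟮α⟯] at key
  refine key.trans_eq ?_
  ring

open IntermediateField Module in
theorem one_le_absMulHeight₁ {Ω : Type*} [Field Ω] [CharZero Ω] (α : Ω) :
    1 ≤ absMulHeight₁ α := by
  rw [absMulHeight₁]
  split_ifs with h
  · have : FiniteDimensional ℚ ℚ⟮α⟯ := adjoin.finiteDimensional h
    have : NumberField ℚ⟮α⟯ := {}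
    exact Real.one_le_rpow (Height.one_le_mulHeight₁ _) (by positivity)
  · exact le_rfl

open Module in
/-- A number field has the Northcott property for the absolute height. -/
theorem finite_absMulHeight₁_le {Ω : Type*} [Field Ω] [CharZero Ω] (F : IntermediateField ℚ Ω)
    [NumberField F] (X : ℝ) : {α : Ω | α ∈ F ∧ absMulHeight₁ α ≤ X}.Finite := by
  refine ((NumberField.finite_setOfPred_mulHeight₁_le F (X ^ finrank ℚ F)).image
    (algebraMap F Ω)).subset ?_
  rintro α ⟨hα, hX⟩
  refine ⟨⟨α, hα⟩, ?_, rfl⟩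
  rw [Set.mem_ofPred_eq, mulHeight₁_eq_absMulHeight₁_pow (algebraMap F Ω)]
  exact pow_le_pow_left₀ (zero_le_one.trans (one_le_absMulHeight₁ _)) hX _

open IntermediateField Module in
/-- The quantity in the infimum over `M` is bounded in terms of the height of any generator of
`M / F`, with an exponent that depends on `K₀` only. -/
theorem relDiscrNorm_rpow_le {Ω : Type*} [Field Ω] [CharZero Ω] [IsAlgClosure ℚ Ω]
    (K₀ F M : IntermediateField ℚ Ω) [NumberField K₀] [NumberField F] (h₀ : K₀ ≤ F) (h : F ≤ M)
    (α : Ω) (hM : M = F ⊔ ℚ⟮α⟯) :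
    (relDiscrNorm F M h : ℝ) ^
        (1 / ((fieldDegree K₀ M (h₀.trans h) : ℝ) * (fieldDegree F M h : ℝ))) ≤
      (4 * absMulHeight₁ α ^ 4) ^ finrank ℚ K₀ := by
  have hH := one_le_absMulHeight₁ α
  have hdeg {E : IntermediateField ℚ Ω} (hE : E ≤ M) :
      finrank ℚ E * fieldDegree E M hE = finrank ℚ M :=
    finrank_mul_finrank ℚ E (extendScalars hE)
  have : Algebra.IsAlgebraic ℚ Ω := IsAlgClosure.isAlgebraic
  have : FiniteDimensional ℚ ℚ⟮α⟯ := adjoin.finiteDimensional (Algebra.IsIntegral.isIntegral α)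
  have : FiniteDimensional ℚ F := NumberField.to_finiteDimensional
  have : FiniteDimensional ℚ M := hM ▸ inferInstance
  have hpos : 0 < finrank ℚ M := finrank_pos
  have h1 := hdeg h
  have h2 := hdeg (h₀.trans h)
  have hF : 0 < fieldDegree F M h := Nat.pos_of_mul_pos_left (h1 ▸ hpos)
  have hK : 0 < fieldDegree K₀ M (h₀.trans h) := Nat.pos_of_mul_pos_left (h2 ▸ hpos)
  have hexp : finrank ℚ F * fieldDegree F M h ^ 2 =
      finrank ℚ K₀ * (fieldDegree K₀ M (h₀.trans h) * fieldDegree F M h) := by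
    rw [sq, ← mul_assoc, h1, ← mul_assoc, h2]
  have key := relDiscrNorm_adjoin_le F M h α hM
  rw [hexp, pow_mul] at key
  refine (Real.rpow_le_rpow (by positivity) key (by positivity)).trans_eq ?_
  rw [one_div, ← Nat.cast_mul, Real.pow_rpow_inv_natCast (by positivity) (by positivity)]

/-! ### The Northcott property -/

theorem theorem1p3 {Ω : Type*} [Field Ω] [CharZero Ω] [IsAlgClosure ℚ Ω]
    (K : ℕ → IntermediateField ℚ Ω) [∀ i, NumberField (K i)] (hK : StrictMono K)
    (L : IntermediateField ℚ Ω) (hL : (L : Set Ω) = ⋃ i, (K i : Set Ω))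
    (hinf : Filter.Tendsto
      (fun i : ℕ ↦ ⨅ M : {M : IntermediateField ℚ Ω // K i < M ∧ M ≤ K (i + 1)},
        (relDiscrNorm (K i) M.1 M.2.1.le : ℝ) ^
          (1 / ((fieldDegree (K 0) M.1 ((hK.monotone (Nat.zero_le i)).trans M.2.1.le) : ℝ) *
            (fieldDegree (K i) M.1 M.2.1.le : ℝ))))
      Filter.atTop Filter.atTop) :
    HasNorthcottProperty (L : Set Ω) := by
  intro X hX
  obtain ⟨i₀, hi₀⟩ := Filter.eventually_atTop.mp
    (hinf.eventually_gt_atTop ((4 * X ^ 4) ^ Module.finrank ℚ (K 0)))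
  refine (finite_absMulHeight₁_le (K i₀) X).subset ?_
  rintro α ⟨hαL, hαX⟩
  refine ⟨?_, hαX⟩
  by_contra hα
  rw [hL, Set.mem_iUnion] at hαL
  obtain ⟨k, hk⟩ := hαL
  -- The stage at which `α` enters the tower.
  have hex : ∃ i, i₀ ≤ i ∧ α ∉ K i ∧ α ∈ K (i + 1) := by
    by_contra! hcon
    have hnot : ∀ i, i₀ ≤ i → α ∉ K i := fun i hi ↦
      Nat.le_induction hα (fun j hj hjα ↦ hcon j hj hjα) i hi
    exact hnot (max i₀ k) (le_max_left _ _) (hK.monotone (le_max_right i₀ k) hk)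
  obtain ⟨i, hi, hαi, hαi1⟩ := hex
  let M : {M : IntermediateField ℚ Ω // K i < M ∧ M ≤ K (i + 1)} :=
    ⟨K i ⊔ IntermediateField.adjoin ℚ {α}, by
      refine left_lt_sup.mpr fun hle ↦ hαi (hle (IntermediateField.mem_adjoin_simple_self ℚ α)),
      sup_le (hK.monotone i.le_succ) (IntermediateField.adjoin_simple_le_iff.mpr hαi1)⟩
  have hlt := (hi₀ i hi).trans_le (ciInf_le
    ⟨0, by rintro _ ⟨M, rfl⟩; positivity⟩ M)
  have hle := relDiscrNorm_rpow_le (K 0) (K i) M.1 (hK.monotone (Nat.zero_le i)) M.2.1.le α rfl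
  have hmono : (4 * absMulHeight₁ α ^ 4) ^ Module.finrank ℚ (K 0) ≤
      (4 * X ^ 4) ^ Module.finrank ℚ (K 0) := by
    have := one_le_absMulHeight₁ α
    gcongr
  exact (hlt.trans_le (hle.trans hmono)).false
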